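/- Notation. Let $p_1,p_2$ be primes, $N=p_1p_2$, $\zeta_n=e^{2\pi i/n}$ and $\phi=\zeta_{24}^{(p_1-1)(p_2-1)}$. Let $\eta$ be the Dedekind eta function and $T=\begin{pmatrix}1&1\\0&1\end{pmatrix}$. For a function $f$ on the upper half plane, $f\circ T$ denotes $z\mapsto f(Tz)=f(z+1)$. Put $$A_\nu(z)=\frac{\eta\left(\frac{z+\nu}{p_1}\right)\eta\left(\frac{z+\nu}{p_2}\right)}{\eta(z+\nu)\,\eta\left(\frac{z+\nu}{p_1p_2}\right)}\quad(0\le\nu<N),\qquad B(z)=\frac{\eta(p_1z)\,\eta(p_2z)}{\eta(z)\,\eta(p_1p_2z)}.$$ If $p_1\ne p_2$, fix integers $u,v$ with $up_1+vp_2=1$, and for $0\le\nu<p_2$ put $$C_{2,\nu}(z)=\phi^{\theta_2(\nu)}\,\varepsilon_2\,\frac{\eta(p_1(z+\nu))\,\eta\left(\frac{z+\nu}{p_2}\right)}{\eta(z+\nu)\,\eta\left(\frac{p_1(z+\nu)}{p_2}\right)}.$$ Here $\varepsilon_2=\left(\frac{p_1}{p_2}\right)$ (Legendre symbol) if $p_2\ne2$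 and $\varepsilon_2=1$ if $p_2=2$. For $0<\nu<p_2$, let $\mu\in\{1,\dots,p_2-1\}$ be determined by $\nu\equiv-(\mu p_1)^{-1}\pmod{p_2}$, and let $v_2=(1+p_1\mu\nu)/p_2$; then $\theta_2(\nu)=\mu((p_2+1)v_2+1)+\nu$ if $p_2\ne2$, and $\theta_2(\nu)=(3p_1+2)\frac{\nu+1}{2}$ if $p_2=2$. Finally $\theta_2(0)=uv(p_2+1)+u-1$ if $p_2\ne2$, and $\theta_2(0)=\frac{(3u+2)(u-1)}{2}$ if $p_2=2$. If $p_1=p_2=p$, for $1\le\nu<p$ choose integers $\mu,v$ with $1=-\mu\nu+vp$ and put $$C_\nu(z)=\sqrt p\;\varepsilon(\nu)\,\zeta_{24}^{\theta(\nu)}\,\frac{\eta(pz)^2}{\eta(z)\,\eta\left(z+\frac{\nu}{p}\right)}.$$ Here $\varepsilon(\nu)=\left(\frac{-\nu}{p}\right)$ and $\theta(\nu)=p\nu(1-\mu^2)+(-3p+2+v)\mu-3+3p$ if $p$ is odd, while $\varepsilon(\nu)=1$ and $\theta(\nu)=0$ if $p=2$. Proposition. The following identities of functions on the upper half plane hold.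 (i) $B\circ T=\phi^{-1}B$. (ii) $A_\nu\circ T=A_{\nu+1}$ for $0\le\nu<N-1$, and $A_{N-1}\circ T=\phi^{-1}A_0$. (iii) If $p_1\ne p_2$, then $C_{2,\nu}\circ T=\phi^{\theta_2(\nu)-\theta_2(\nu+1)}\,C_{2,\nu+1}$ for $0\le\nu<p_2-1$, and $C_{2,p_2-1}\circ T=\phi^{\theta_2(p_2-1)-\theta_2(0)+1}\,C_{2,0}$. (iv) If $p_1=p_2=p$, then $C_\nu\circ T=\zeta_{24}^{2p-2}\,C_\nu$ for $1\le\nu<p$. -/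

import Mathlib

open scoped UpperHalfPlane MatrixGroups

noncomputable section

namespace DoubleEta

/-- The function `f ∘ M : z ↦ f (M z)` for `M ∈ SL₂(ℤ)` acting on the upper half plane by
Moebius transformations. -/
def compMoebius (f : ℍ → ℂ) (M : SL(2, ℤ)) : ℍ → ℂ := fun z => f (M • z)

/-- `ζ_n = exp (2 π i / n)`. -/
def zeta (n : ℕ) : ℂ := Complex.exp (2 * Real.pi * Complex.I / n)

/-- `φ = ζ_24 ^ ((p₁ - 1) (p₂ - 1))`. -/
def phi (p₁ p₂ : ℕ) : ℂ := zeta 24 ^ (((p₁ : ℤ) - 1) * ((p₂ : ℤ) - 1))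

/-- The double eta quotient
`w_{p₁,p₂}(z) = η(z/p₁) η(z/p₂) / (η(z/(p₁ p₂)) η(z))`. -/
def w (p₁ p₂ : ℕ) (z : ℂ) : ℂ :=
  (ModularForm.eta (z / p₁) * ModularForm.eta (z / p₂)) /
    (ModularForm.eta (z / (p₁ * p₂)) * ModularForm.eta z)

/-- `A_ν(z) = w_{p₁,p₂}(z + ν)`. -/
def A (p₁ p₂ ν : ℕ) (z : ℍ) : ℂ := w p₁ p₂ ((z : ℂ) + ν)

/-- `B(z) = η(p₁ z) η(p₂ z) / (η(z) η(p₁ p₂ z))`. -/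
def B (p₁ p₂ : ℕ) (z : ℍ) : ℂ :=
  (ModularForm.eta (p₁ * z) * ModularForm.eta (p₂ * z)) /
    (ModularForm.eta z * ModularForm.eta (p₁ * p₂ * z))

/-- For `0 < ν < p₂`: the integer `μ ∈ {1, …, p₂ - 1}` with `ν ≡ -(μ p₁)⁻¹ (mod p₂)`, that is,
`μ ≡ -(ν p₁)⁻¹ (mod p₂)`. -/
def mu₂ (p₁ p₂ ν : ℕ) : ℕ := (-((ν : ZMod p₂) * (p₁ : ZMod p₂))⁻¹).val

/-- `v₂ = (1 + p₁ μ ν) / p₂`; for distinct primes and `0 < ν < p₂` the division is exact, see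
`mul_v₂`. -/
def v₂ (p₁ p₂ ν : ℕ) : ℕ := (1 + p₁ * mu₂ p₁ p₂ ν * ν) / p₂

/-- The exponent `θ₂(ν)`, depending on integers `u, v` with `u p₁ + v p₂ = 1`. Both halves are
exact: for `p₂ = 2` the only `ν > 0` is `ν = 1`, and `u` is odd. -/
def theta₂ (p₁ p₂ : ℕ) (u v : ℤ) (ν : ℕ) : ℤ :=
  if ν = 0 then
    if p₂ = 2 then (3 * u + 2) * (u - 1) / 2 else u * v * (p₂ + 1) + u - 1
  else
    if p₂ = 2 then (3 * p₁ + 2) * ((ν + 1) / 2)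
    else mu₂ p₁ p₂ ν * ((p₂ + 1) * v₂ p₁ p₂ ν + 1) + ν

/-- `ε₂` is the Legendre symbol `(p₁ / p₂)` if `p₂ ≠ 2`, and `1` if `p₂ = 2`. -/
def eps₂ (p₁ p₂ : ℕ) [Fact p₂.Prime] : ℤ := if p₂ = 2 then 1 else legendreSym p₂ p₁

/-- `C_{2,ν}(z) = φ^{θ₂(ν)} ε₂ η(p₁ (z+ν)) η((z+ν)/p₂) / (η(z+ν) η(p₁ (z+ν)/p₂))`. -/
def C₂ (p₁ p₂ : ℕ) [Fact p₂.Prime] (u v : ℤ) (ν : ℕ) (z : ℍ) : ℂ :=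
  phi p₁ p₂ ^ theta₂ p₁ p₂ u v ν * (eps₂ p₁ p₂ : ℂ) *
    ((ModularForm.eta (p₁ * ((z : ℂ) + ν)) * ModularForm.eta (((z : ℂ) + ν) / p₂)) /
      (ModularForm.eta ((z : ℂ) + ν) * ModularForm.eta (p₁ * ((z : ℂ) + ν) / p₂)))

/-- The exponent `θ(ν)`, written with integers `μ, v` such that `1 = -μ ν + v p`. -/
def theta (p ν : ℕ) (μ v : ℤ) : ℤ :=
  if p = 2 then 0 else p * ν * (1 - μ ^ 2) + (-3 * p + 2 + v) * μ - 3 + 3 * p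

/-- `ε(ν)` is the Legendre symbol `(-ν / p)` if `p` is odd, and `1` if `p = 2`. -/
def eps (p : ℕ) [Fact p.Prime] (ν : ℕ) : ℤ := if p = 2 then 1 else legendreSym p (-(ν : ℤ))

/-- `C_ν(z) = √p ε(ν) ζ_24^{θ(ν)} η(p z)² / (η(z) η(z + ν/p))`. -/
def C (p : ℕ) [Fact p.Prime] (ν : ℕ) (μ v : ℤ) (z : ℍ) : ℂ :=
  (Real.sqrt p : ℂ) * (eps p ν : ℂ) * zeta 24 ^ theta p ν μ v *
    (ModularForm.eta (p * z) ^ 2 /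
      (ModularForm.eta z * ModularForm.eta ((z : ℂ) + (ν : ℂ) / p)))

theorem mul_v₂ (p₁ p₂ ν : ℕ) [Fact p₁.Prime] [Fact p₂.Prime] (h : p₁ ≠ p₂) (h0 : 0 < ν)
    (hν : ν < p₂) : p₂ * v₂ p₁ p₂ ν = 1 + p₁ * mu₂ p₁ p₂ ν * ν := by
  refine Nat.mul_div_cancel' ?_
  have hν0 : (ν : ZMod p₂) ≠ 0 := by
    rw [Ne, ZMod.natCast_eq_zero_iff]
    exact Nat.not_dvd_of_pos_of_lt h0 hν
  have hp0 : (p₁ : ZMod p₂) ≠ 0 := by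
    rw [Ne, ZMod.natCast_eq_zero_iff, Nat.prime_dvd_prime_iff_eq Fact.out Fact.out]
    exact fun h' => h h'.symm
  rw [← ZMod.natCast_eq_zero_iff]
  push_cast
  rw [mu₂, ZMod.natCast_zmod_val]
  field_simp
  ring

theorem B_eq (p₁ p₂ : ℕ) [Fact p₁.Prime] [Fact p₂.Prime] (z : ℍ) :
    B p₁ p₂ z = w p₁ p₂ (p₁ * p₂ * z) := by
  have h1 : (p₁ : ℂ) ≠ 0 := by exact_mod_cast (Fact.out : p₁.Prime).ne_zero
  have h2 : (p₂ : ℂ) ≠ 0 := by exact_mod_cast (Fact.out : p₂.Prime).ne_zero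
  have e1 : (p₁ : ℂ) * p₂ * z / p₁ = p₂ * z := by field_simp
  have e2 : (p₁ : ℂ) * p₂ * z / p₂ = p₁ * z := by field_simp
  have e3 : (p₁ : ℂ) * p₂ * z / (p₁ * p₂) = z := by field_simp
  rw [B, w, e1, e2, e3, mul_comm (ModularForm.eta (p₁ * z))]

end DoubleEta

end

namespace DoubleEta

/-! Everything reduces to η(z + n) = ζ₂₄ⁿ η(z) for integers n (`eta_add_intCast`). When a
translation moves all four eta arguments of a quotient by integers, the quotient is multiplied by
ζ₂₄ to the signed sum of the shifts (`zpow_quotient`); for the double quotients this sum is ±(p₁ -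
1)(p₂ - 1), giving φ or φ⁻¹. The remaining cases only relabel ν, and the constants θ₂ and θ enter
purely formally. -/

theorem zeta_ne_zero (n : ℕ) : zeta n ≠ 0 := Complex.exp_ne_zero _

theorem phi_ne_zero (p₁ p₂ : ℕ) : phi p₁ p₂ ≠ 0 := zpow_ne_zero _ (zeta_ne_zero 24)

theorem zeta_zpow (n : ℕ) (k : ℤ) :
    zeta n ^ k = Complex.exp (k * (2 * Real.pi * Complex.I / n)) := by
  rw [zeta, ← Complex.exp_int_mul]

theorem qParam_twentyFour_add_intCast (z : ℂ) (n : ℤ) :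
    Function.Periodic.qParam 24 (z + n) = zeta 24 ^ n * Function.Periodic.qParam 24 z := by
  rw [zeta_zpow, Function.Periodic.qParam, Function.Periodic.qParam, ← Complex.exp_add]
  congr 1
  push_cast
  ring

/-- The factors of the eta product depend on z only through exp(2πiz), so only the prefactor
exp(2πiz/24) sees the shift. -/
theorem eta_q_add_intCast (k : ℕ) (z : ℂ) (n : ℤ) :
    ModularForm.eta_q k (z + n) = ModularForm.eta_q k z := by
  rw [ModularForm.eta_q, ModularForm.eta_q, Function.Periodic.qParam, Function.Periodic.qParam]
  congr 1
  rw [Complex.exp_eq_exp_iff_exists_int]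
  exact ⟨n, by push_cast; ring⟩

/-- The Dedekind eta function picks up a 24th root of unity under integer translations. -/
theorem eta_add_intCast (z : ℂ) (n : ℤ) :
    ModularForm.eta (z + n) = zeta 24 ^ n * ModularForm.eta z := by
  simp only [ModularForm.eta, qParam_twentyFour_add_intCast, eta_q_add_intCast, mul_assoc]

theorem eta_add_natCast (z : ℂ) (n : ℕ) :
    ModularForm.eta (z + n) = zeta 24 ^ (n : ℤ) * ModularForm.eta z := by
  simpa using eta_add_intCast z n

theorem zpow_quotient {ζ : ℂ} (hζ : ζ ≠ 0) (a b c d : ℤ) (x y x' y' : ℂ) :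
    (ζ ^ a * x) * (ζ ^ b * y) / ((ζ ^ c * x') * (ζ ^ d * y')) =
      ζ ^ (a + b - c - d) * (x * y / (x' * y')) := by
  rw [zpow_sub₀ hζ, zpow_sub₀ hζ, zpow_add₀ hζ]
  simp only [div_eq_mul_inv, mul_inv]
  ring

/-- The double eta quotient is multiplied by `φ⁻¹` under translation by `p₁ p₂`. -/
theorem w_add_mul (p₁ p₂ : ℕ) (h1 : (p₁ : ℂ) ≠ 0) (h2 : (p₂ : ℂ) ≠ 0) (z : ℂ) :
    w p₁ p₂ (z + p₁ * p₂) = (phi p₁ p₂)⁻¹ * w p₁ p₂ z := by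
  have e1 : (z + p₁ * p₂) / p₁ = z / p₁ + p₂ := by field_simp
  have e2 : (z + p₁ * p₂) / p₂ = z / p₂ + p₁ := by field_simp
  have e3 : (z + p₁ * p₂) / (p₁ * p₂) = z / (p₁ * p₂) + (1 : ℕ) := by field_simp; simp
  have e4 : z + (p₁ : ℂ) * p₂ = z + (p₁ * p₂ : ℕ) := by push_cast; rfl
  rw [w, e1, e2, e3, e4]
  simp only [eta_add_natCast]
  rw [zpow_quotient (zeta_ne_zero 24), w, phi, ← zpow_neg]
  -- The exponent is p₂ + p₁ - 1 - p₁p₂ = -(p₁ - 1)(p₂ - 1).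
  congr 2
  push_cast
  ring

theorem coe_T_smul (z : ℍ) : ((ModularGroup.T • z : ℍ) : ℂ) = z + 1 := by
  rw [UpperHalfPlane.modular_T_smul, UpperHalfPlane.coe_vadd]
  push_cast
  ring

theorem B_T (p₁ p₂ : ℕ) [Fact p₁.Prime] [Fact p₂.Prime] :
    compMoebius (B p₁ p₂) ModularGroup.T = (phi p₁ p₂)⁻¹ • B p₁ p₂ := by
  have h1 : (p₁ : ℂ) ≠ 0 := by exact_mod_cast (Fact.out : p₁.Prime).ne_zero
  have h2 : (p₂ : ℂ) ≠ 0 := by exact_mod_cast (Fact.out : p₂.Prime).ne_zero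
  funext z
  -- As B(z) = w(p₁p₂z), a unit shift of z is a shift by p₁p₂ in w.
  rw [compMoebius, Pi.smul_apply, smul_eq_mul, B_eq, B_eq, coe_T_smul, mul_add, mul_one,
    w_add_mul p₁ p₂ h1 h2]

theorem A_T (p₁ p₂ ν : ℕ) :
    compMoebius (A p₁ p₂ ν) ModularGroup.T = A p₁ p₂ (ν + 1) := by
  funext z
  rw [compMoebius, A, A, coe_T_smul]
  congr 1
  push_cast
  ring

theorem A_mul (p₁ p₂ : ℕ) [Fact p₁.Prime] [Fact p₂.Prime] :
    A p₁ p₂ (p₁ * p₂) = (phi p₁ p₂)⁻¹ • A p₁ p₂ 0 := by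
  have h1 : (p₁ : ℂ) ≠ 0 := by exact_mod_cast (Fact.out : p₁.Prime).ne_zero
  have h2 : (p₂ : ℂ) ≠ 0 := by exact_mod_cast (Fact.out : p₂.Prime).ne_zero
  funext z
  rw [Pi.smul_apply, smul_eq_mul, A, A, Nat.cast_mul, w_add_mul p₁ p₂ h1 h2, Nat.cast_zero,
    add_zero]

/-- The eta quotient in `C₂`, without its constant factor. -/
noncomputable def etaQuotient₂ (p₁ p₂ : ℕ) (z : ℂ) : ℂ :=
  (ModularForm.eta (p₁ * z) * ModularForm.eta (z / p₂)) /
    (ModularForm.eta z * ModularForm.eta (p₁ * z / p₂))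

theorem etaQuotient₂_add (p₁ p₂ : ℕ) (h2 : (p₂ : ℂ) ≠ 0) (z : ℂ) :
    etaQuotient₂ p₁ p₂ (z + p₂) = phi p₁ p₂ * etaQuotient₂ p₁ p₂ z := by
  have e1 : (p₁ : ℂ) * (z + p₂) = p₁ * z + (p₁ * p₂ : ℕ) := by push_cast; ring
  have e2 : (z + p₂) / p₂ = z / p₂ + (1 : ℕ) := by field_simp; simp
  have e3 : (p₁ * z + (p₁ * p₂ : ℕ)) / p₂ = p₁ * z / p₂ + p₁ := by push_cast; field_simp
  rw [etaQuotient₂, e1, e2, e3]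
  simp only [eta_add_natCast]
  rw [zpow_quotient (zeta_ne_zero 24), etaQuotient₂, phi]
  -- The exponent is p₁p₂ + 1 - p₂ - p₁ = (p₁ - 1)(p₂ - 1).
  congr 2
  push_cast
  ring

theorem C₂_eq (p₁ p₂ : ℕ) [Fact p₂.Prime] (u v : ℤ) (ν : ℕ) (z : ℍ) :
    C₂ p₁ p₂ u v ν z =
      phi p₁ p₂ ^ theta₂ p₁ p₂ u v ν * (eps₂ p₁ p₂ : ℂ) * etaQuotient₂ p₁ p₂ (z + ν) := rfl

theorem C₂_T (p₁ p₂ : ℕ) [Fact p₂.Prime] (u v : ℤ) (ν : ℕ) :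
    compMoebius (C₂ p₁ p₂ u v ν) ModularGroup.T =
      phi p₁ p₂ ^ (theta₂ p₁ p₂ u v ν - theta₂ p₁ p₂ u v (ν + 1)) • C₂ p₁ p₂ u v (ν + 1) := by
  funext z
  have e : (z : ℂ) + 1 + ν = z + (ν + 1 : ℕ) := by push_cast; ring
  rw [compMoebius, Pi.smul_apply, smul_eq_mul, C₂_eq, C₂_eq, coe_T_smul, e, ← mul_assoc,
    ← mul_assoc, ← zpow_add₀ (phi_ne_zero p₁ p₂), sub_add_cancel]

/-- Here the argument reaches z + p₂, and wrapping back to z costs the extra factor φ. -/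
theorem C₂_T_last (p₁ p₂ : ℕ) [Fact p₂.Prime] (u v : ℤ) :
    compMoebius (C₂ p₁ p₂ u v (p₂ - 1)) ModularGroup.T =
      phi p₁ p₂ ^ (theta₂ p₁ p₂ u v (p₂ - 1) - theta₂ p₁ p₂ u v 0 + 1) • C₂ p₁ p₂ u v 0 := by
  have hp : 1 ≤ p₂ := (Fact.out : p₂.Prime).one_le
  have h2 : (p₂ : ℂ) ≠ 0 := by exact_mod_cast (Fact.out : p₂.Prime).ne_zero
  funext z
  have e : (z : ℂ) + 1 + (p₂ - 1 : ℕ) = z + p₂ := by push_cast [hp]; ring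
  have hφ : phi p₁ p₂ ^ theta₂ p₁ p₂ u v (p₂ - 1) * phi p₁ p₂ =
      phi p₁ p₂ ^ (theta₂ p₁ p₂ u v (p₂ - 1) - theta₂ p₁ p₂ u v 0 + 1) *
        phi p₁ p₂ ^ theta₂ p₁ p₂ u v 0 := by
    rw [← zpow_add₀ (phi_ne_zero p₁ p₂), ← zpow_add_one₀ (phi_ne_zero p₁ p₂)]
    congr 1
    ring
  rw [compMoebius, Pi.smul_apply, smul_eq_mul, C₂_eq, C₂_eq, coe_T_smul, e,
    etaQuotient₂_add p₁ p₂ h2, Nat.cast_zero, add_zero]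
  linear_combination (eps₂ p₁ p₂ : ℂ) * etaQuotient₂ p₁ p₂ z * hφ

theorem C_T (p : ℕ) [Fact p.Prime] (ν : ℕ) (μ v : ℤ) :
    compMoebius (C p ν μ v) ModularGroup.T = zeta 24 ^ (2 * (p : ℤ) - 2) • C p ν μ v := by
  funext z
  have e1 : (p : ℂ) * (z + 1) = p * z + p := by ring
  have e2 : (z : ℂ) + 1 = z + (1 : ℕ) := by simp
  have e3 : (z : ℂ) + (1 : ℕ) + (ν : ℂ) / p = z + ν / p + (1 : ℕ) := by ring
  have hexp : (p : ℤ) + p - (1 : ℕ) - (1 : ℕ) = 2 * p - 2 := by push_cast; ring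
  rw [compMoebius, Pi.smul_apply, smul_eq_mul, C, C, coe_T_smul, e1, e2, e3]
  simp only [eta_add_natCast, sq]
  rw [zpow_quotient (zeta_ne_zero 24), hexp]
  ring

end DoubleEta

theorem mainTheorem4 (p₁ p₂ : ℕ) [Fact p₁.Prime] [Fact p₂.Prime] :
    -- (i)
    DoubleEta.compMoebius (DoubleEta.B p₁ p₂) ModularGroup.T
      = (DoubleEta.phi p₁ p₂)⁻¹ • DoubleEta.B p₁ p₂ ∧
    -- (ii)
    (∀ ν : ℕ, ν < p₁ * p₂ - 1 →
      DoubleEta.compMoebius (DoubleEta.A p₁ p₂ ν) ModularGroup.T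
        = DoubleEta.A p₁ p₂ (ν + 1)) ∧
    DoubleEta.compMoebius (DoubleEta.A p₁ p₂ (p₁ * p₂ - 1)) ModularGroup.T
      = (DoubleEta.phi p₁ p₂)⁻¹ • DoubleEta.A p₁ p₂ 0 ∧
    -- (iii)
    (p₁ ≠ p₂ → ∀ u v : ℤ, u * p₁ + v * p₂ = 1 →
      (∀ ν : ℕ, ν < p₂ - 1 →
        DoubleEta.compMoebius (DoubleEta.C₂ p₁ p₂ u v ν) ModularGroup.T
          = DoubleEta.phi p₁ p₂
              ^ (DoubleEta.theta₂ p₁ p₂ u v ν - DoubleEta.theta₂ p₁ p₂ u v (ν + 1))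
            • DoubleEta.C₂ p₁ p₂ u v (ν + 1)) ∧
      DoubleEta.compMoebius (DoubleEta.C₂ p₁ p₂ u v (p₂ - 1)) ModularGroup.T
        = DoubleEta.phi p₁ p₂
            ^ (DoubleEta.theta₂ p₁ p₂ u v (p₂ - 1) - DoubleEta.theta₂ p₁ p₂ u v 0 + 1)
          • DoubleEta.C₂ p₁ p₂ u v 0) ∧
    -- (iv)
    (∀ p : ℕ, ∀ [Fact p.Prime], p₁ = p → p₂ = p →
      ∀ ν : ℕ, 1 ≤ ν → ν < p → ∀ μ v : ℤ, 1 = -μ * ν + v * p →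
        DoubleEta.compMoebius (DoubleEta.C p ν μ v) ModularGroup.T
          = DoubleEta.zeta 24 ^ (2 * (p : ℤ) - 2) • DoubleEta.C p ν μ v) := by
  refine ⟨DoubleEta.B_T p₁ p₂, fun ν _ => DoubleEta.A_T p₁ p₂ ν, ?_, fun _ u v _ =>
    ⟨fun ν _ => DoubleEta.C₂_T p₁ p₂ u v ν, DoubleEta.C₂_T_last p₁ p₂ u v⟩,
    fun p _ _ _ ν _ _ μ v _ => DoubleEta.C_T p ν μ v⟩
  have hN : 1 ≤ p₁ * p₂ :=
    Nat.mul_pos (Fact.out : p₁.Prime).pos (Fact.out : p₂.Prime).pos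
  -- The shift passes through the out-of-range index ν = p₁p₂, which `A_mul` folds back to 0.
  rw [DoubleEta.A_T, Nat.sub_add_cancel hN, DoubleEta.A_mul]
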